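/- Let $K$ be a field of characteristic $0$, let $p\geq 1$ and $n_1,\dots,n_p\geq 1$ be integers, and put $n=n_1+\cdots+n_p$. Let $z_1,\dots,z_p$ be indeterminates, and let $A$ be an $n\times n$ block matrix with blocks $A_{[ab]}$ of size $n_a\times n_b$ $(1\leq a,b\leq p)$ such that $A_{[aa]}=z_aI_{n_a}$ for every $a$ and such that, for $a\neq b$, the block $A_{[ab]}$ has entries in $K$. A cyclic walk is a list of length $k\geq 2$ of elements of $\{1,\dots,p\}$, taken up to cyclic permutation and written $\rho=(\!(a_1,\dots,a_k)\!)$, such that $a_1\neq a_2,\ \dots,\ a_{k-1}\neq a_k,\ a_k\neq a_1$. Its valuation is the order of the stabiliser of $(a_1,\dots,a_k)$ under the action of $\mathbb Z/k\mathbb Z$ by cyclic permutations, and $\rho$ is prime if its valuation is $1$. Let $\mathcal P$ be the set of prime cyclic walks. For $\rho=(\!(a_1,\dots,a_k)\!)$ and $1\leq a\leq p$, let $v_a(\rho)=|\{i : a_i=a\}|$ and $\underline v(\rho)=(v_1(\rho),\dots,v_p(\rho))$, and write $$\det\big(I-t\,\mathrm{hol}(-A,\rho)\big)=\det\big(I_{n_{a_1}}-t\,(-A)_{[a_1a_2]}(-A)_{[a_2a_3]}\cdots(-A)_{[a_ka_1]}\big),$$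 which does not depend on the choice of the base point $a_1$ of $\rho$. For $\underline m\in\mathbb Z^p$ write $\underline z^{\underline m}=z_1^{m_1}\cdots z_p^{m_p}$, and let $\underline n=(n_1,\dots,n_p)$. Then, in the ring $K[[z_1^{-1},\dots,z_p^{-1}]][z_1,\dots,z_p]$ of formal Laurent series in $z_1^{-1},\dots,z_p^{-1}$, the (in general infinite) product below converges coefficientwise, unconditionally, and $$\det A=\underline z^{\underline n}\prod_{\rho\in\mathcal P}\det\big(I-\underline z^{-\underline v(\rho)}\,\mathrm{hol}(-A,\rho)\big).$$ -/

import Mathlib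

noncomputable section

namespace BlockEuler

/-! ### Formal Laurent series in `z₁⁻¹, …, z_p⁻¹` -/

/-- Formal Laurent series over `K` in the `p` variables `z₁⁻¹, …, z_p⁻¹`: the coefficient at
`m : Fin p → ℤ` is the coefficient of `(z₁⁻¹) ^ m₁ ⋯ (z_p⁻¹) ^ m_p`.  A subset of `ℤ ^ p` is partially
well-ordered for the product order exactly when it is bounded below, so this is the ring of families
of coefficients supported in some translate of `ℕ ^ p`, that is, the ring of formal power series in
`z₁⁻¹, …, z_p⁻¹` with these variables inverted. -/
abbrev LaurentInv (p : ℕ) (K : Type*) [Field K] : Type _ := HahnSeries (Fin p → ℤ) K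

/-- The topology of coefficientwise convergence, the field of coefficients being discrete. -/
instance LaurentInv.topologicalSpace (p : ℕ) (K : Type*) [Field K] :
    TopologicalSpace (LaurentInv p K) :=
  TopologicalSpace.induced HahnSeries.coeff (@Pi.topologicalSpace (Fin p → ℤ) (fun _ => K) fun _ => ⊥)

/-- The monomial `z ^ m = z₁ ^ m₁ ⋯ z_p ^ m_p`, for a vector of integers `m`. -/
def zPow {p : ℕ} (K : Type*) [Field K] (m : Fin p → ℤ) : LaurentInv p K :=
  HahnSeries.single (-m) 1

/-- The indeterminate `z_a`. -/
def zVar {p : ℕ} (K : Type*) [Field K] (a : Fin p) : LaurentInv p K :=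
  zPow K (Pi.single a 1)

/-! ### Cyclic walks -/

/-- Number of rotations (by `0 ≤ i < k`, where `k` is the length) that fix a list. -/
def listValuation {α : Type*} [DecidableEq α] (l : List α) : ℕ :=
  ((Finset.range l.length).filter fun i => l.rotate i = l).card

theorem listValuation_rotate {α : Type*} [DecidableEq α] (l : List α) (k : ℕ) :
    listValuation (l.rotate k) = listValuation l := by
  unfold listValuation
  rw [List.length_rotate]
  congr 1
  ext i
  simp only [Finset.mem_filter, and_congr_right_iff]
  intro _
  rw [List.rotate_rotate, Nat.add_comm, ← List.rotate_rotate, List.rotate_eq_rotate]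

/-- The valuation of a cyclically ordered list of length `k`: the order of the stabiliser, under the
action of `ℤ / k ℤ` by rotation, of any list representing it. -/
def valuation {α : Type*} [DecidableEq α] (c : Cycle α) : ℕ :=
  Quotient.liftOn c listValuation (by
    rintro l _ ⟨k, rfl⟩
    exact (listValuation_rotate l k).symm)

/-- A cyclic walk: a cyclically ordered list of length at least `2` of elements of `Fin p`, in which
any two (cyclically) successive elements are distinct. -/
def IsCyclicWalk {p : ℕ} (c : Cycle (Fin p)) : Prop :=
  2 ≤ c.length ∧ c.Chain (· ≠ ·)

/-- The set of prime cyclic walks: the cyclic walks of valuation `1`. -/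
def PrimeCyclicWalk (p : ℕ) : Type :=
  {c : Cycle (Fin p) // IsCyclicWalk c ∧ valuation c = 1}

/-- The number of visits of a cyclically ordered list at `a`. -/
def visits {p : ℕ} (c : Cycle (Fin p)) (a : Fin p) : ℕ :=
  c.toMultiset.count a

/-! ### Block matrices and holonomies -/

section Blocks

variable {p : ℕ} {n : Fin p → ℕ} {R : Type*} [CommRing R]

/-- The block `A_[ab]`, of size `n a × n b`, of a block matrix `A`; the pair `⟨a, i⟩` is the `i`-th
index of the `a`-th block. -/
def block (A : Matrix (Σ a, Fin (n a)) (Σ a, Fin (n a)) R) (a b : Fin p) :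
    Matrix (Fin (n a)) (Fin (n b)) R :=
  Matrix.of fun i j => A ⟨a, i⟩ ⟨b, j⟩

/-- `pathProd A a b [c₁, …, c_r]` is the product `A_[a c₁] A_[c₁ c₂] ⋯ A_[c_r b]` of blocks. -/
def pathProd (A : Matrix (Σ a, Fin (n a)) (Σ a, Fin (n a)) R) :
    (a b : Fin p) → List (Fin p) → Matrix (Fin (n a)) (Fin (n b)) R
  | a, b, [] => block A a b
  | a, b, c :: l => block A a c * pathProd A c b l

theorem pathProd_concat (A : Matrix (Σ a, Fin (n a)) (Σ a, Fin (n a)) R) (b c : Fin p)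
    (l : List (Fin p)) : ∀ a : Fin p,
      pathProd A a b (l ++ [c]) = pathProd A a c l * block A c b := by
  induction l with
  | nil => intro a; rfl
  | cons d l ih =>
    intro a
    simp only [List.cons_append, pathProd]
    rw [ih, Matrix.mul_assoc]

/-- `det (I - t A_[a₁a₂] ⋯ A_[a_k a₁])` for a list `[a₁, …, a_k]`, that is, with the holonomy based at
`a₁`; it is `1` for the empty list. -/
def listHolDet (A : Matrix (Σ a, Fin (n a)) (Σ a, Fin (n a)) R) (t : R) : List (Fin p) → R
  | [] => 1
  | a :: l => (1 - t • pathProd A a a l).det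

theorem listHolDet_rotate_one (A : Matrix (Σ a, Fin (n a)) (Σ a, Fin (n a)) R) (t : R)
    (l : List (Fin p)) : listHolDet A t (l.rotate 1) = listHolDet A t l := by
  match l with
  | [] => rfl
  | [a] => simp
  | a :: b :: l =>
    simp only [List.rotate_cons_succ, List.rotate_zero, List.cons_append, listHolDet, pathProd]
    rw [pathProd_concat, ← Matrix.mul_smul, Matrix.det_one_sub_mul_comm, Matrix.smul_mul]

theorem listHolDet_rotate (A : Matrix (Σ a, Fin (n a)) (Σ a, Fin (n a)) R) (t : R)
    (l : List (Fin p)) (k : ℕ) : listHolDet A t (l.rotate k) = listHolDet A t l := by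
  induction k with
  | zero => rw [List.rotate_zero]
  | succ k ih => rw [← List.rotate_rotate, listHolDet_rotate_one, ih]

/-- `det (I - t hol(A, c))` for a cyclically ordered list `c`, where `hol(A, c)` is the product of the
blocks of `A` along `c` from any base point: the determinant does not depend on the base point. -/
def holDet (A : Matrix (Σ a, Fin (n a)) (Σ a, Fin (n a)) R) (t : R) (c : Cycle (Fin p)) : R :=
  Quotient.liftOn c (listHolDet A t) (by
    rintro l _ ⟨k, rfl⟩
    exact (listHolDet_rotate A t l k).symm)

end Blocks

end BlockEuler

end

noncomputable section

namespace BlockEuler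

/-! ### The Euler derivation and the degree filtration -/

section Laurent

variable {p : ℕ} {K : Type*} [Field K]

/-! Dividing each row of blocks by its indeterminate gives `A = diag(z) (1 - X)` with `X = scaled
A`. The diagonal blocks of `X` vanish and its entries are homogeneous of degree 1 in the inverse
variables. The scaling turns the holonomy of `-A` along `ρ`, times its monomial, into the holonomy
of `X`. It remains to prove `det (1 - X) = ∏ det (1 - hol(X, ρ))`.

Both sides have constant term 1, so it suffices to compare logarithmic derivatives along the Euler
derivation `E = euler`. By Jacobi's formula, `E f = -T f` with `T = ∑ tr X^k` for the left side, and
`T = |ρ| ∑ tr hol(X, ρ)^j` for each factor (`derivation_det_one_sub`). Expanding `tr X^k` over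
closed walks, each walk is a power of a unique prime root, and a prime walk of length `ℓ` has `ℓ`
distinct rotations. So the two sums of traces agree (`sum_words_eq_sum_prime`). In characteristic
zero, `E f = -T f` determines `f` degree by degree from its constant term (`sub_mem_filt_of_euler`).

No logarithm or infinite sum occurs. Everything is done modulo degree `N + 1`, with any finite set
of primes containing those of length at most `N`, so the same estimate yields unconditional
convergence. -/

theorem euler_support_subset (f : LaurentInv p K) :
    (Function.support fun m : Fin p → ℤ => ((∑ a, m a : ℤ) : K) * f.coeff m) ⊆ f.support := by
  intro m hm
  rw [Function.mem_support] at hm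
  exact right_ne_zero_of_mul hm

/-- Multiplication of the coefficient at `m` by the total degree of `m`. -/
def eulerFun (f : LaurentInv p K) : LaurentInv p K where
  coeff m := ((∑ a, m a : ℤ) : K) * f.coeff m
  isPWO_support' := f.isPWO_support.mono (euler_support_subset f)

theorem coeff_eulerFun (f : LaurentInv p K) (m : Fin p → ℤ) :
    (eulerFun f).coeff m = ((∑ a, m a : ℤ) : K) * f.coeff m := rfl

theorem support_eulerFun_subset (f : LaurentInv p K) : (eulerFun f).support ⊆ f.support :=
  euler_support_subset f

/-- The Euler derivation `∑ₐ -zₐ ∂/∂zₐ`, whose eigenvectors are the homogeneous series. -/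
def euler : Derivation ℤ (LaurentInv p K) (LaurentInv p K) :=
  Derivation.mk'
    (AddMonoidHom.toIntLinearMap
      { toFun := eulerFun
        map_zero' := by ext m; simp [coeff_eulerFun]
        map_add' := fun f g => by ext m; simp [coeff_eulerFun, mul_add] })
    (fun f g => by
      change eulerFun (f * g) = f • eulerFun g + g • eulerFun f
      ext m
      rw [smul_eq_mul, smul_eq_mul, mul_comm g, HahnSeries.coeff_add, coeff_eulerFun,
        HahnSeries.coeff_mul_right' g.isPWO_support (support_eulerFun_subset g),
        HahnSeries.coeff_mul_left' f.isPWO_support (support_eulerFun_subset f),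
        HahnSeries.coeff_mul, Finset.mul_sum, ← Finset.sum_add_distrib]
      refine Finset.sum_congr rfl fun ij hij => ?_
      have h : ij.1 + ij.2 = m := (Finset.mem_antidiagonal.1 hij).2.2
      rw [← h, coeff_eulerFun, coeff_eulerFun]
      simp only [Pi.add_apply, Finset.sum_add_distrib, Int.cast_add]
      ring)

theorem coeff_euler (f : LaurentInv p K) (m : Fin p → ℤ) :
    (euler f).coeff m = ((∑ a, m a : ℤ) : K) * f.coeff m := rfl

/-- The series all of whose monomials have total degree at least `k` in `z₁⁻¹, …, z_p⁻¹`. -/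
def filt (p : ℕ) (K : Type*) [Field K] (k : ℕ) : AddSubgroup (LaurentInv p K) where
  carrier := {f | ∀ m : Fin p → ℤ, ∑ a, m a < k → f.coeff m = 0}
  zero_mem' := fun m _ => HahnSeries.coeff_zero
  add_mem' := fun {f g} hf hg m hm => by rw [HahnSeries.coeff_add, hf m hm, hg m hm, add_zero]
  neg_mem' := fun {f} hf m hm => by rw [HahnSeries.coeff_neg, hf m hm, neg_zero]

theorem mem_filt {k : ℕ} {f : LaurentInv p K} :
    f ∈ filt p K k ↔ ∀ m : Fin p → ℤ, ∑ a, m a < k → f.coeff m = 0 := Iff.rfl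

theorem filt_anti {k l : ℕ} (h : k ≤ l) : filt p K l ≤ filt p K k :=
  fun _ hf m hm => hf m (by omega)

theorem mul_mem_filt {k l : ℕ} {f g : LaurentInv p K} (hf : f ∈ filt p K k)
    (hg : g ∈ filt p K l) : f * g ∈ filt p K (k + l) := by
  intro m hm
  rw [HahnSeries.coeff_mul]
  refine Finset.sum_eq_zero fun ij hij => ?_
  have h : ij.1 + ij.2 = m := (Finset.mem_antidiagonal.1 hij).2.2
  rw [← h] at hm
  simp only [Pi.add_apply, Finset.sum_add_distrib, Nat.cast_add] at hm
  rcases lt_or_ge (∑ a, ij.1 a) (k : ℤ) with h1 | h1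
  · rw [hf _ h1, zero_mul]
  · rw [hg _ (by omega), mul_zero]

theorem one_mem_filt : (1 : LaurentInv p K) ∈ filt p K 0 := by
  intro m hm
  rw [HahnSeries.coeff_one, if_neg]
  rintro rfl
  simp at hm

theorem mul_mem_filt_left {k : ℕ} {f g : LaurentInv p K} (hf : f ∈ filt p K k)
    (hg : g ∈ filt p K 0) : f * g ∈ filt p K k := mul_mem_filt hf hg

theorem mul_mem_filt_right {k : ℕ} {f g : LaurentInv p K} (hf : f ∈ filt p K 0)
    (hg : g ∈ filt p K k) : f * g ∈ filt p K k := by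
  simpa using mul_mem_filt hf hg

theorem prod_mem_filt {ι : Type*} (s : Finset ι) (f : ι → LaurentInv p K)
    (h : ∀ i ∈ s, f i ∈ filt p K 0) : ∏ i ∈ s, f i ∈ filt p K 0 := by
  classical
  induction s using Finset.induction_on with
  | empty => simpa using one_mem_filt
  | insert i s hi ih =>
    rw [Finset.prod_insert hi]
    exact mul_mem_filt_left (h i (by simp)) (ih fun j hj => h j (by simp [hj]))

theorem prod_sub_prod_mem_filt {ι : Type*} (s : Finset ι) (f g : ι → LaurentInv p K)
    (hf : ∀ i ∈ s, f i ∈ filt p K 0) (hg : ∀ i ∈ s, g i ∈ filt p K 0)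
    (h : ∀ i ∈ s, f i - g i ∈ filt p K 1) : ∏ i ∈ s, f i - ∏ i ∈ s, g i ∈ filt p K 1 := by
  classical
  induction s using Finset.induction_on with
  | empty => simp
  | insert i s hi ih =>
    rw [Finset.prod_insert hi, Finset.prod_insert hi]
    have e : f i * ∏ i ∈ s, f i - g i * ∏ i ∈ s, g i
        = (f i - g i) * ∏ i ∈ s, f i + g i * (∏ i ∈ s, f i - ∏ i ∈ s, g i) := by ring
    rw [e]
    exact add_mem (mul_mem_filt_left (h i (by simp))
        (prod_mem_filt _ _ fun j hj => hf j (by simp [hj])))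
      (mul_mem_filt_right (hg i (by simp)) (ih (fun j hj => hf j (by simp [hj]))
        (fun j hj => hg j (by simp [hj])) fun j hj => h j (by simp [hj])))

/-- In characteristic zero an eigenvector of eigenvalue `d` is homogeneous of degree `d`: the
coefficient at `m` is killed by `deg m - d`. -/
theorem mem_filt_of_euler_eq [CharZero K] {d : ℕ} {f : LaurentInv p K}
    (h : euler f = (d : LaurentInv p K) * f) : f ∈ filt p K d := by
  intro m hm
  have h1 := congrArg (fun g => HahnSeries.coeff g m) h
  simp only [coeff_euler, ← nsmul_eq_mul, HahnSeries.coeff_smul] at h1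
  rw [nsmul_eq_mul, ← sub_eq_zero, ← sub_mul] at h1
  refine (mul_eq_zero.1 h1).resolve_left fun h2 => ?_
  have h3 : ((∑ a, m a - d : ℤ) : K) = 0 := by push_cast at h2 ⊢; exact h2
  have := Int.cast_eq_zero.1 h3
  omega

/-- On the component of degree exactly `k`, `euler` is multiplication by `k`, which is invertible
because `k ≥ 1`. -/
theorem mem_filt_succ_of_euler_mem [CharZero K] {k : ℕ} (hk : 1 ≤ k) {f : LaurentInv p K}
    (hf : f ∈ filt p K k) (h : euler f ∈ filt p K (k + 1)) : f ∈ filt p K (k + 1) := by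
  intro m hm
  rcases lt_or_ge (∑ a, m a) (k : ℤ) with h1 | h1
  · exact hf m h1
  · have h2 := h m hm
    rw [coeff_euler] at h2
    refine (mul_eq_zero.1 h2).resolve_left fun h3 => ?_
    have := Int.cast_eq_zero.1 h3
    omega

/-- Modulo degree `N + 1`, the solution `f` of `euler f = -T f` with constant term `1` is unique. -/
theorem sub_mem_filt_of_euler [CharZero K] {N : ℕ} {f g T U : LaurentInv p K}
    (hf : f - 1 ∈ filt p K 1) (hg : g - 1 ∈ filt p K 1) (hT : T ∈ filt p K 1)
    (hTU : T - U ∈ filt p K (N + 1))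
    (hfT : euler f + T * f ∈ filt p K (N + 1)) (hgU : euler g + U * g ∈ filt p K (N + 1)) :
    f - g ∈ filt p K (N + 1) := by
  have hg0 : g ∈ filt p K 0 := by
    simpa using add_mem (filt_anti (Nat.zero_le 1) hg) one_mem_filt
  have key : euler (f - g) + T * (f - g) ∈ filt p K (N + 1) := by
    have e : euler (f - g) + T * (f - g)
        = (euler f + T * f) - (euler g + U * g) - (T - U) * g := by
      rw [map_sub]; ring
    rw [e]
    exact sub_mem (sub_mem hfT hgU) (mul_mem_filt_left hTU hg0)
  have h1 : f - g ∈ filt p K 1 := by simpa using sub_mem hf hg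
  -- Bootstrapping: `T` has positive degree, so `T * (f - g)` lies one step deeper than `f - g`. By
  -- `key`, so does `euler (f - g)`, hence so does `f - g`.
  have main : ∀ k, k ≤ N → f - g ∈ filt p K (k + 1) := by
    intro k
    induction k with
    | zero => exact fun _ => h1
    | succ k ih =>
      intro hk
      have hk1 := ih (by omega)
      refine mem_filt_succ_of_euler_mem (by omega) hk1 ?_
      have h2 : T * (f - g) ∈ filt p K (k + 1 + 1) := by
        rw [add_comm (k + 1)]
        exact mul_mem_filt hT hk1
      simpa using sub_mem (filt_anti (by omega) key) h2
  exact main N le_rfl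

theorem euler_zPow (m : Fin p → ℤ) :
    euler (zPow K m) = ((-∑ a, m a : ℤ) : LaurentInv p K) * zPow K m := by
  ext k
  have h0 : (((-∑ a, m a : ℤ) : LaurentInv p K) * zPow K m).coeff k
      = ((-∑ a, m a : ℤ) : K) * (zPow K m).coeff k := by
    rw [← zsmul_eq_mul, ← zsmul_eq_mul]; rfl
  rw [coeff_euler, h0, zPow, HahnSeries.coeff_single]
  split_ifs with h
  · rw [h]; simp
  · simp

theorem euler_C (c : K) : euler (HahnSeries.C c : LaurentInv p K) = 0 := by
  ext k
  rw [coeff_euler, HahnSeries.C_apply, HahnSeries.coeff_single]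
  split_ifs with h
  · rw [h]; simp
  · simp

theorem zPow_zero : zPow K (0 : Fin p → ℤ) = 1 := by
  rw [zPow, neg_zero]; rfl

theorem zPow_add (m k : Fin p → ℤ) : zPow K (m + k) = zPow K m * zPow K k := by
  rw [zPow, zPow, zPow, HahnSeries.single_mul_single, neg_add, one_mul]

theorem prod_zPow {ι : Type*} (s : Finset ι) (f : ι → Fin p → ℤ) :
    ∏ i ∈ s, zPow K (f i) = zPow K (∑ i ∈ s, f i) := by
  classical
  induction s using Finset.induction_on with
  | empty => simp [zPow_zero]
  | insert i s hi ih => rw [Finset.prod_insert hi, Finset.sum_insert hi, ih, zPow_add]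

/-! ### Coefficientwise convergence -/

/-- Uniqueness of limits is what identifies `∏'` with the limit found below. -/
instance LaurentInv.t2Space : T2Space (LaurentInv p K) := by
  let _ : TopologicalSpace K := ⊥
  have : DiscreteTopology K := ⟨rfl⟩
  exact T2Space.of_injective_continuous HahnSeries.coeff_injective
    (continuous_induced_dom (f := (HahnSeries.coeff : LaurentInv p K → _)))

theorem tendsto_of_sub_mem_filt {ι : Type*} {l : Filter ι} {u : ι → LaurentInv p K}
    {f : LaurentInv p K} (h : ∀ N : ℕ, ∀ᶠ i in l, f - u i ∈ filt p K (N + 1)) :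
    Filter.Tendsto u l (nhds f) := by
  let _ : TopologicalSpace K := ⊥
  rw [nhds_induced, Filter.tendsto_comap_iff]
  refine tendsto_pi_nhds.2 fun m => ?_
  refine Filter.Tendsto.congr' (f₁ := fun _ => f.coeff m) ?_ tendsto_const_nhds
  -- Order `deg m + 1` fixes the coefficient at `m`; for negative degree `toNat` gives 0, which is
  -- enough.
  filter_upwards [h (∑ a, m a).toNat] with i hi
  have := hi m (by push_cast; omega)
  rw [HahnSeries.coeff_sub, sub_eq_zero] at this
  exact this

end Laurent

/-! ### Logarithmic derivatives of determinants -/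

section Det

open Matrix

variable {S R ι : Type*} [CommRing S] [CommRing R] [Algebra S R] [Fintype ι] [DecidableEq ι]

theorem derivation_prod {κ : Type*} [DecidableEq κ] (D : Derivation S R R) (s : Finset κ)
    (f : κ → R) : D (∏ i ∈ s, f i) = ∑ i ∈ s, (∏ j ∈ s.erase i, f j) * D (f i) := by
  induction s using Finset.induction_on with
  | empty => simp
  | insert i s hi ih =>
    rw [Finset.prod_insert hi, Derivation.leibniz, ih, Finset.sum_insert hi,
      Finset.erase_insert hi, smul_eq_mul, smul_eq_mul, add_comm, Finset.mul_sum]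
    congr 1
    refine Finset.sum_congr rfl fun j hj => ?_
    have hij : i ≠ j := fun h => hi (h ▸ hj)
    rw [Finset.erase_insert_of_ne hij, Finset.prod_insert (by simp [hi])]
    ring

/-- Jacobi's formula. -/
theorem derivation_det (D : Derivation S R R) (A : Matrix ι ι R) :
    D A.det = (A.adjugate * A.map D).trace := by
  -- Cramer's rule turns the trace into the sum of determinants in which one column is
  -- differentiated.
  have h1 : ∀ i, (A.adjugate * A.map D) i i = (A.updateCol i fun j => D (A j i)).det := by
    intro i
    rw [← cramer_apply, cramer_eq_adjugate_mulVec]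
    rfl
  simp only [trace, diag, h1, det_apply, map_sum]
  rw [Finset.sum_comm]
  refine Finset.sum_congr rfl fun σ _ => ?_
  rw [Units.smul_def, map_zsmul, derivation_prod, Finset.smul_sum]
  refine Finset.sum_congr rfl fun i _ => ?_
  rw [← Finset.prod_erase_mul _ _ (Finset.mem_univ i)]
  congr 2
  · refine Finset.prod_congr rfl fun j hj => ?_
    rw [updateCol_ne (Finset.ne_of_mem_erase hj)]
  · rw [updateCol_self]

/-- Jacobi's formula with `(1 - Y)⁻¹ Y` replaced by a finite geometric sum. The adjugate stands for
the inverse, and the remainder carries the factor `Y ^ (M + 1)`, of high degree in the application.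
-/
theorem derivation_det_one_sub (D : Derivation S R R) (Y : Matrix ι ι R) (d : R)
    (hY : ∀ i j, D (Y i j) = d * Y i j) (M : ℕ) :
    D (1 - Y).det + (d * ∑ j ∈ Finset.range M, (Y ^ (j + 1)).trace) * (1 - Y).det
      = -(d * ((1 - Y).adjugate * Y ^ (M + 1)).trace) := by
  have h1 : (1 - Y).map D = -(d • Y) := by
    ext i j
    have : D ((1 : Matrix ι ι R) i j) = 0 := by
      rw [Matrix.one_apply]; split_ifs <;> simp
    simp [map_sub, this, hY]
  have h2 : (1 - Y).adjugate * Y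
      = (1 - Y).det • ∑ j ∈ Finset.range M, Y ^ (j + 1) + (1 - Y).adjugate * Y ^ (M + 1) := by
    have h3 : Y = (1 - Y) * ∑ j ∈ Finset.range M, Y ^ (j + 1) + Y ^ (M + 1) := by
      have := mul_neg_geom_sum Y M
      simp only [pow_succ]
      rw [← Finset.sum_mul, ← mul_assoc, this]
      noncomm_ring
    have h4 := congrArg ((1 - Y).adjugate * ·) h3
    simpa only [mul_add, ← mul_assoc, adjugate_mul, smul_mul_assoc, one_mul] using h4
  rw [derivation_det, h1, mul_neg, Matrix.mul_smul, h2]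
  simp only [trace_neg, trace_smul, trace_add, trace_sum, smul_eq_mul]
  ring

end Det

/-! ### Degree estimates for matrices and determinants -/

section DetFilt

open Matrix

variable {p : ℕ} {K : Type*} [Field K]

theorem matrix_one_mem_filt {ι : Type*} [DecidableEq ι] (i j : ι) : (1 : Matrix ι ι (LaurentInv p K)) i j ∈ filt p K 0 := by
  rw [one_apply]
  split_ifs
  exacts [one_mem_filt, zero_mem _]

variable {ι : Type*} [Fintype ι]

theorem matrix_mul_mem_filt {κ κ' : Type*} {k l : ℕ} {Y : Matrix κ ι (LaurentInv p K)}
    {Z : Matrix ι κ' (LaurentInv p K)} (hY : ∀ i j, Y i j ∈ filt p K k)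
    (hZ : ∀ i j, Z i j ∈ filt p K l) (i : κ) (j : κ') : (Y * Z) i j ∈ filt p K (k + l) := by
  rw [mul_apply]
  exact sum_mem fun c _ => mul_mem_filt (hY i c) (hZ c j)

variable [DecidableEq ι]

theorem matrix_pow_mem_filt {k : ℕ} {Y : Matrix ι ι (LaurentInv p K)}
    (hY : ∀ i j, Y i j ∈ filt p K k) (r : ℕ) : ∀ i j, (Y ^ r) i j ∈ filt p K (k * r) := by
  induction r with
  | zero => simpa using matrix_one_mem_filt
  | succ r ih =>
    rw [pow_succ, Nat.mul_succ]
    exact matrix_mul_mem_filt ih hY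

theorem det_mem_filt {Y : Matrix ι ι (LaurentInv p K)} (hY : ∀ i j, Y i j ∈ filt p K 0) :
    Y.det ∈ filt p K 0 := by
  rw [det_apply]
  refine sum_mem fun σ _ => ?_
  rw [Units.smul_def]
  exact zsmul_mem (prod_mem_filt _ _ fun i _ => hY _ _) _

theorem adjugate_mem_filt {Y : Matrix ι ι (LaurentInv p K)} (hY : ∀ i j, Y i j ∈ filt p K 0)
    (i j : ι) : Y.adjugate i j ∈ filt p K 0 := by
  rw [adjugate_apply]
  refine det_mem_filt fun k l => ?_
  rw [updateRow_apply]
  split_ifs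
  · rw [Pi.single_apply]
    split_ifs
    exacts [one_mem_filt, zero_mem _]
  · exact hY k l

theorem det_one_sub_sub_one_mem_filt {Y : Matrix ι ι (LaurentInv p K)}
    (hY : ∀ i j, Y i j ∈ filt p K 1) : (1 - Y).det - 1 ∈ filt p K 1 := by
  have h0 : ∀ i j, (1 - Y) i j ∈ filt p K 0 := fun i j =>
    sub_mem (matrix_one_mem_filt i j) (filt_anti (Nat.zero_le 1) (hY i j))
  rw [← det_one (n := ι) (R := LaurentInv p K), det_apply, det_apply, ← Finset.sum_sub_distrib]
  refine sum_mem fun σ _ => ?_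
  rw [← smul_sub, Units.smul_def]
  refine zsmul_mem (prod_sub_prod_mem_filt _ _ _ (fun i _ => h0 _ _)
    (fun i _ => matrix_one_mem_filt _ _) fun i _ => ?_) _
  rw [Matrix.sub_apply, sub_sub_cancel_left]
  exact neg_mem (hY _ _)

theorem euler_det_one_sub_mem_filt {d : ℕ} {Y : Matrix ι ι (LaurentInv p K)}
    (h : ∀ i j, euler (Y i j) = (d : LaurentInv p K) * Y i j)
    (hY : ∀ i j, Y i j ∈ filt p K 1) (M : ℕ) :
    euler (1 - Y).det + ((d : LaurentInv p K) * ∑ j ∈ Finset.range M, (Y ^ (j + 1)).trace)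
      * (1 - Y).det ∈ filt p K (M + 1) := by
  have h0 : ∀ i j, (1 - Y) i j ∈ filt p K 0 := fun i j =>
    sub_mem (matrix_one_mem_filt i j) (filt_anti (Nat.zero_le 1) (hY i j))
  rw [derivation_det_one_sub euler Y d h M, ← nsmul_eq_mul]
  refine neg_mem (nsmul_mem (sum_mem fun i _ => ?_) _)
  have := matrix_mul_mem_filt (adjugate_mem_filt h0) (matrix_pow_mem_filt hY (M + 1)) i i
  simpa using this

end DetFilt

/-- Logarithmic derivatives add over products; the cofactors have degree at least 0, so they do not
spoil the error terms. -/
theorem prod_euler_mem_filt {p : ℕ} {K : Type*} [Field K] {κ : Type*} {N : ℕ} (s : Finset κ)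
    (f T : κ → LaurentInv p K) (hf : ∀ i ∈ s, f i - 1 ∈ filt p K 1)
    (h : ∀ i ∈ s, euler (f i) + T i * f i ∈ filt p K (N + 1)) :
    ∏ i ∈ s, f i - 1 ∈ filt p K 1 ∧
      euler (∏ i ∈ s, f i) + (∑ i ∈ s, T i) * ∏ i ∈ s, f i ∈ filt p K (N + 1) := by
  classical
  have hf0 : ∀ i ∈ s, f i ∈ filt p K 0 := fun i hi => by
    simpa using add_mem (filt_anti (Nat.zero_le 1) (hf i hi)) one_mem_filt
  constructor
  · simpa using prod_sub_prod_mem_filt s f (fun _ => 1) hf0 (fun _ _ => one_mem_filt) hf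
  · rw [derivation_prod, Finset.sum_mul, ← Finset.sum_add_distrib]
    refine sum_mem fun i hi => ?_
    rw [← Finset.prod_erase_mul s f hi]
    have e : (∏ j ∈ s.erase i, f j) * euler (f i) + T i * ((∏ j ∈ s.erase i, f j) * f i)
        = (∏ j ∈ s.erase i, f j) * (euler (f i) + T i * f i) := by ring
    rw [e]
    exact mul_mem_filt_right
      (prod_mem_filt _ _ fun j hj => hf0 j (Finset.mem_of_mem_erase hj)) (h i hi)

/-! ### Primitive roots of lists -/

section Lists

open Function

variable {α : Type*}

/-- The concatenation of `j` copies of a list. -/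
def listPow (l : List α) (j : ℕ) : List α := (List.replicate j l).flatten

theorem listPow_zero (l : List α) : listPow l 0 = [] := rfl

theorem listPow_succ (l : List α) (j : ℕ) : listPow l (j + 1) = l ++ listPow l j := rfl

theorem length_listPow (l : List α) (j : ℕ) : (listPow l j).length = j * l.length := by
  simp [listPow]

theorem append_listPow_append (u v : List α) (j : ℕ) :
    u ++ listPow (v ++ u) j = listPow (u ++ v) j ++ u := by
  induction j with
  | zero => simp [listPow_zero]
  | succ j ih => rw [listPow_succ, listPow_succ, List.append_assoc, List.append_assoc, ih]; simp

theorem listPow_rotate_of_le (l : List α) {i : ℕ} (hi : i ≤ l.length) (j : ℕ) :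
    (listPow l j).rotate i = listPow (l.rotate i) j := by
  cases j with
  | zero => simp [listPow_zero]
  | succ j =>
    rw [List.rotate_eq_drop_append_take hi]
    obtain ⟨u, v, rfl, rfl⟩ : ∃ u v, l = u ++ v ∧ i = u.length :=
      ⟨l.take i, l.drop i, (List.take_append_drop i l).symm, by simp [hi]⟩
    rw [listPow_succ, List.append_assoc, List.rotate_append_length_eq, List.drop_left,
      List.take_left, listPow_succ, List.append_assoc, List.append_assoc, ← append_listPow_append]

theorem listPow_rotate (l : List α) (i j : ℕ) :
    (listPow l j).rotate i = listPow (l.rotate i) j := by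
  induction i with
  | zero => simp
  | succ i ih =>
    rw [← List.rotate_rotate, ih, ← List.rotate_rotate]
    rcases Nat.eq_zero_or_pos (l.rotate i).length with h | h
    · rw [List.length_eq_zero_iff.1 h]; simp [listPow]
    · exact listPow_rotate_of_le _ h j

theorem listPow_injective {j : ℕ} (hj : 0 < j) {l l' : List α}
    (h : listPow l j = listPow l' j) : l = l' := by
  have hl : l.length = l'.length := by
    have := congrArg List.length h
    rw [length_listPow, length_listPow] at this
    exact Nat.eq_of_mul_eq_mul_left hj this
  obtain ⟨i, rfl⟩ := Nat.exists_eq_succ_of_ne_zero hj.ne'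
  rw [Nat.succ_eq_add_one, listPow_succ, listPow_succ] at h
  exact (List.append_inj h hl).1

theorem iterate_rotate_one (l : List α) (i : ℕ) :
    (fun w : List α => w.rotate 1)^[i] l = l.rotate i := by
  induction i with
  | zero => simp
  | succ i ih => rw [iterate_succ_apply', ih, List.rotate_rotate]

theorem isPeriodicPt_rotate_iff {l : List α} {i : ℕ} :
    IsPeriodicPt (fun w : List α => w.rotate 1) i l ↔ l.rotate i = l := by
  rw [IsPeriodicPt, IsFixedPt, iterate_rotate_one]

/-- The smallest positive `i` such that the rotation by `i` fixes a list. -/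
def rotPeriod (l : List α) : ℕ := minimalPeriod (fun w : List α => w.rotate 1) l

theorem rotate_eq_self_iff {l : List α} {i : ℕ} : l.rotate i = l ↔ rotPeriod l ∣ i := by
  rw [← isPeriodicPt_rotate_iff, isPeriodicPt_iff_minimalPeriod_dvd, rotPeriod]

theorem rotPeriod_dvd_length (l : List α) : rotPeriod l ∣ l.length :=
  rotate_eq_self_iff.1 (List.rotate_length l)

/-- Rotation commutes with taking powers, and powers are injective, so a list and its powers are
fixed by the same rotations. -/
theorem rotPeriod_listPow (l : List α) {j : ℕ} (hj : 0 < j) :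
    rotPeriod (listPow l j) = rotPeriod l := by
  refine Nat.dvd_antisymm ?_ ?_
  · rw [← rotate_eq_self_iff, listPow_rotate, rotate_eq_self_iff.2 dvd_rfl]
  · rw [← rotate_eq_self_iff]
    refine listPow_injective hj ?_
    rw [← listPow_rotate, rotate_eq_self_iff.2 dvd_rfl]

theorem eq_listPow_of_append_comm {u v : List α} {q : ℕ} (h : u ++ v = v ++ u)
    (hl : v.length = q * u.length) : v = listPow u q := by
  induction q generalizing v with
  | zero => simpa [listPow_zero] using hl
  | succ q ih =>
    have hle : u.length ≤ v.length := by rw [hl, Nat.succ_mul]; omega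
    obtain ⟨v', rfl⟩ : u <+: v :=
      List.prefix_of_prefix_length_le (List.prefix_append u v) (h ▸ List.prefix_append v u) hle
    rw [listPow_succ, ← ih]
    · rw [List.append_assoc] at h
      exact List.append_cancel_left h
    · rw [List.length_append, Nat.succ_mul] at hl
      omega

/-- The root is the prefix whose length is the rotation period: invariance under that rotation says
that the prefix commutes with the rest of `w`, which is therefore a power of it. -/
theorem exists_listPow_eq {w : List α} (hw : w ≠ []) :
    ∃ u : List α, ∃ j, 0 < j ∧ u ≠ [] ∧ rotPeriod u = u.length ∧ listPow u j = w := by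
  obtain ⟨q, hq⟩ := rotPeriod_dvd_length w
  have hpos : 0 < w.length := List.length_pos_iff.2 hw
  have hd : 0 < rotPeriod w := Nat.pos_of_ne_zero fun h => by rw [h] at hq; omega
  have hq0 : 0 < q := Nat.pos_of_ne_zero fun h => by rw [h] at hq; omega
  have hle : rotPeriod w ≤ w.length := Nat.le_of_dvd hpos (rotPeriod_dvd_length w)
  have hlen : (w.take (rotPeriod w)).length = rotPeriod w := by simp [hle]
  have hrot := rotate_eq_self_iff.2 (dvd_refl (rotPeriod w))
  rw [List.rotate_eq_drop_append_take hle] at hrot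
  obtain ⟨r, rfl⟩ := Nat.exists_eq_succ_of_ne_zero hq0.ne'
  have hv := eq_listPow_of_append_comm (u := w.take (rotPeriod w)) (v := w.drop (rotPeriod w))
    (q := r) (by rw [hrot, List.take_append_drop]) (by
      rw [hlen, List.length_drop, hq, Nat.mul_succ, mul_comm]; omega)
  have hpow : listPow (w.take (rotPeriod w)) (r + 1) = w := by
    rw [listPow_succ, ← hv, List.take_append_drop]
  refine ⟨w.take (rotPeriod w), r + 1, r.succ_pos, ?_, ?_, hpow⟩
  · rw [← List.length_pos_iff, hlen]; exact hd
  · rw [hlen, ← rotPeriod_listPow _ r.succ_pos, hpow]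

theorem listValuation_eq_one_iff [DecidableEq α] {l : List α} (hl : l ≠ []) :
    listValuation l = 1 ↔ rotPeriod l = l.length := by
  have hpos : 0 < l.length := List.length_pos_iff.2 hl
  have hd : 0 < rotPeriod l := Nat.pos_of_dvd_of_pos (rotPeriod_dvd_length l) hpos
  have h0 : 0 ∈ (Finset.range l.length).filter fun i => l.rotate i = l := by simp [hpos]
  rw [listValuation]
  constructor
  · intro h
    obtain ⟨x, hx⟩ := Finset.card_eq_one.1 h
    have hx0 : x = 0 := by rw [hx, Finset.mem_singleton] at h0; exact h0.symm
    refine le_antisymm (Nat.le_of_dvd hpos (rotPeriod_dvd_length l)) (not_lt.1 fun hlt => ?_)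
    have : rotPeriod l ∈ (Finset.range l.length).filter fun i => l.rotate i = l := by
      simp [hlt, rotate_eq_self_iff]
    rw [hx, hx0, Finset.mem_singleton] at this
    omega
  · intro h
    rw [Finset.card_eq_one]
    refine ⟨0, Finset.eq_singleton_iff_unique_mem.2 ⟨h0, fun i hi => ?_⟩⟩
    rw [Finset.mem_filter, Finset.mem_range, rotate_eq_self_iff, h] at hi
    exact Nat.eq_zero_of_dvd_of_lt hi.2 hi.1

theorem rotPeriod_rotate (l : List α) (i : ℕ) : rotPeriod (l.rotate i) = rotPeriod l := by
  have key : ∀ k, (l.rotate i).rotate k = l.rotate i ↔ l.rotate k = l := fun k => by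
    rw [List.rotate_rotate, Nat.add_comm, ← List.rotate_rotate, List.rotate_eq_rotate]
  refine Nat.dvd_antisymm ?_ ?_
  · rw [← rotate_eq_self_iff, key, rotate_eq_self_iff]
  · rw [← rotate_eq_self_iff, ← key, rotate_eq_self_iff]

theorem rotate_injOn {l : List α} (h : rotPeriod l = l.length) {i j : ℕ} (hi : i < l.length)
    (hj : j < l.length) (hij : l.rotate i = l.rotate j) : i = j := by
  rw [← iterate_rotate_one, ← iterate_rotate_one] at hij
  rw [← h] at hi hj
  exact iterate_injOn_Iio_minimalPeriod hi hj hij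

theorem exists_rotate_eq_of_isRotated {l l' : List α} (hl : l ≠ []) (h : l ~r l') :
    ∃ i < l.length, l.rotate i = l' := by
  obtain ⟨i, rfl⟩ := h
  exact ⟨i % l.length, Nat.mod_lt _ (List.length_pos_iff.2 hl), List.rotate_mod l i⟩

theorem chain_of_chain_listPow {r : α → α → Prop} {l : List α} {j : ℕ} (hj : 0 < j)
    (h : Cycle.Chain r (listPow l j : Cycle α)) : Cycle.Chain r (l : Cycle α) := by
  match l, j, hj with
  | [], _, _ => exact Cycle.Chain.nil r
  | a :: l, j + 1, _ =>
    rw [listPow_succ, List.cons_append, Cycle.chain_coe_cons] at h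
    rw [Cycle.chain_coe_cons]
    refine List.IsChain.prefix h ?_
    rw [List.cons_prefix_cons]
    refine ⟨rfl, ?_⟩
    rw [List.append_assoc]
    refine (List.prefix_append_right_inj l).2 ?_
    -- The letter after `l` is `a` in either case: it closes the cycle or starts the next copy.
    cases j with
    | zero => simp [listPow_zero]
    | succ j => simp [listPow_succ]

/-- The lists of length `k`. -/
def words (α : Type*) [Fintype α] (k : ℕ) : Finset (List α) :=
  (List.finite_length_eq α k).toFinset

theorem mem_words [Fintype α] {k : ℕ} {l : List α} : l ∈ words α k ↔ l.length = k := by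
  simp [words]

theorem sum_words_succ [Fintype α] {M : Type*} [AddCommMonoid M] (k : ℕ) (f : List α → M) :
    ∑ l ∈ words α (k + 1), f l = ∑ a, ∑ l ∈ words α k, f (a :: l) := by
  rw [← Finset.sum_product']
  symm
  refine Finset.sum_bij (fun x _ => x.1 :: x.2) ?_ ?_ ?_ ?_
  · intro x hx
    simp only [Finset.mem_product, mem_words] at hx
    simp [mem_words, hx.2]
  · rintro ⟨a, l⟩ _ ⟨b, l'⟩ _ h
    simpa using h
  · intro l hl
    rw [mem_words] at hl
    match l, hl with
    | a :: l, hl => exact ⟨(a, l), by simpa [mem_words] using hl, rfl⟩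
  · exact fun _ _ => rfl

end Lists

/-! ### Traces of products of blocks along closed walks -/

section PathProd

open Matrix

variable {p : ℕ} {n : Fin p → ℕ} {R : Type*} [CommRing R]

theorem pathProd_append (A : Matrix (Σ a, Fin (n a)) (Σ a, Fin (n a)) R) (b c : Fin p)
    (l l' : List (Fin p)) : ∀ a : Fin p,
      pathProd A a b (l ++ c :: l') = pathProd A a c l * pathProd A c b l' := by
  induction l with
  | nil => intro a; rfl
  | cons d l ih =>
    intro a
    simp only [List.cons_append, pathProd]
    rw [ih, Matrix.mul_assoc]

/-- `tr (A_[a₁a₂] ⋯ A_[a_k a₁])` for a list `[a₁, …, a_k]`; it is `0` for the empty list. -/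
def listTrace (A : Matrix (Σ a, Fin (n a)) (Σ a, Fin (n a)) R) : List (Fin p) → R
  | [] => 0
  | a :: l => (pathProd A a a l).trace

theorem listTrace_rotate (A : Matrix (Σ a, Fin (n a)) (Σ a, Fin (n a)) R)
    (l : List (Fin p)) (k : ℕ) : listTrace A (l.rotate k) = listTrace A l := by
  induction k with
  | zero => rw [List.rotate_zero]
  | succ k ih =>
    rw [← List.rotate_rotate, ← ih]
    match l.rotate k with
    | [] => rfl
    | [a] => simp
    | a :: b :: l =>
      simp only [List.rotate_cons_succ, List.rotate_zero, List.cons_append, listTrace, pathProd]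
      rw [pathProd_concat, Matrix.trace_mul_comm]

theorem pathProd_pow (A : Matrix (Σ a, Fin (n a)) (Σ a, Fin (n a)) R) (a : Fin p)
    (l : List (Fin p)) (j : ℕ) :
    pathProd A a a l ^ (j + 1) = pathProd A a a (l ++ listPow (a :: l) j) := by
  induction j with
  | zero => simp [listPow_zero]
  | succ j ih => rw [pow_succ', ih, listPow_succ, List.cons_append, pathProd_append]

theorem trace_pathProd_pow (A : Matrix (Σ a, Fin (n a)) (Σ a, Fin (n a)) R) (a : Fin p)
    (l : List (Fin p)) (j : ℕ) :
    (pathProd A a a l ^ (j + 1)).trace = listTrace A (listPow (a :: l) (j + 1)) := by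
  rw [pathProd_pow, listPow_succ]
  rfl

theorem block_mul (A B : Matrix (Σ a, Fin (n a)) (Σ a, Fin (n a)) R) (a b : Fin p) :
    block (A * B) a b = ∑ c, block A a c * block B c b := by
  ext i j
  simp only [block, of_apply, mul_apply, Matrix.sum_apply, Fintype.sum_sigma]

/-- A product of `k + 1` blocks passes through `k` intermediate vertices. -/
theorem block_pow (A : Matrix (Σ a, Fin (n a)) (Σ a, Fin (n a)) R) (k : ℕ) : ∀ a b : Fin p,
    block (A ^ (k + 1)) a b = ∑ l ∈ words (Fin p) k, pathProd A a b l := by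
  induction k with
  | zero =>
    intro a b
    have : words (Fin p) 0 = {[]} := by ext l; simp [mem_words]
    rw [this, Finset.sum_singleton, zero_add, pow_one]
    rfl
  | succ k ih =>
    intro a b
    rw [pow_succ', block_mul, sum_words_succ]
    refine Finset.sum_congr rfl fun c _ => ?_
    rw [ih, Matrix.mul_sum]
    rfl

theorem trace_pow (A : Matrix (Σ a, Fin (n a)) (Σ a, Fin (n a)) R) (k : ℕ) :
    (A ^ (k + 1)).trace = ∑ w ∈ words (Fin p) (k + 1), listTrace A w := by
  have h : ∀ B : Matrix (Σ a, Fin (n a)) (Σ a, Fin (n a)) R,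
      B.trace = ∑ a, (block B a a).trace := fun B => by
    simp only [trace, diag, Fintype.sum_sigma, block, of_apply]
  rw [h, sum_words_succ]
  refine Finset.sum_congr rfl fun a _ => ?_
  rw [block_pow, trace_sum]
  rfl

/-- A repeated consecutive vertex inserts a diagonal block. Hence sums over all words only see
genuine walks. -/
theorem pathProd_eq_zero (A : Matrix (Σ a, Fin (n a)) (Σ a, Fin (n a)) R)
    (hA : ∀ a, block A a a = 0) (b : Fin p) (l : List (Fin p)) : ∀ a : Fin p,
      ¬ List.IsChain (· ≠ ·) (a :: (l ++ [b])) → pathProd A a b l = 0 := by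
  induction l with
  | nil =>
    intro a h
    have : a = b := by simpa using h
    subst this
    exact hA a
  | cons c l ih =>
    intro a h
    rw [List.cons_append, List.isChain_cons_cons, not_and_or, not_not] at h
    rw [pathProd]
    rcases h with rfl | h
    · rw [hA, Matrix.zero_mul]
    · rw [ih c h, Matrix.mul_zero]

theorem listTrace_eq_zero (A : Matrix (Σ a, Fin (n a)) (Σ a, Fin (n a)) R)
    (hA : ∀ a, block A a a = 0) {w : List (Fin p)}
    (h : ¬ Cycle.Chain (· ≠ ·) (w : Cycle (Fin p))) : listTrace A w = 0 := by
  match w with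
  | [] => rfl
  | a :: l =>
    rw [listTrace, pathProd_eq_zero A hA a l a h, Matrix.trace_zero]

theorem derivation_pathProd {S : Type*} [CommRing S] [Algebra S R] (D : Derivation S R R)
    (A : Matrix (Σ a, Fin (n a)) (Σ a, Fin (n a)) R) (hA : ∀ x y, D (A x y) = A x y)
    (b : Fin p) (l : List (Fin p)) : ∀ (a : Fin p) i j,
      D (pathProd A a b l i j) = ((l.length + 1 : ℕ) : R) * pathProd A a b l i j := by
  induction l with
  | nil =>
    intro a i j
    rw [List.length_nil, zero_add, Nat.cast_one, one_mul]
    exact hA _ _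
  | cons c l ih =>
    intro a i j
    simp only [pathProd, mul_apply, map_sum, Finset.mul_sum, Derivation.leibniz, ih, smul_eq_mul]
    refine Finset.sum_congr rfl fun k _ => ?_
    rw [block, of_apply, hA, List.length_cons]
    push_cast
    ring

end PathProd

/-! ### The rescaled off-diagonal part -/

section Scaled

open Matrix

variable {p : ℕ} {n : Fin p → ℕ} {K : Type*} [Field K]

/-- The off-diagonal part of `-A`, with the `a`-th row of blocks divided by `z_a`. -/
def scaled (A : Matrix (Σ a, Fin (n a)) (Σ a, Fin (n a)) (LaurentInv p K)) :
    Matrix (Σ a, Fin (n a)) (Σ a, Fin (n a)) (LaurentInv p K) :=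
  of fun x y => if x.1 = y.1 then 0 else zPow K (-Pi.single x.1 1) * -A x y

variable (A : Matrix (Σ a, Fin (n a)) (Σ a, Fin (n a)) (LaurentInv p K))

theorem block_scaled_self (a : Fin p) : block (scaled A) a a = 0 := by
  ext i j
  simp [block, scaled]

theorem block_scaled_of_ne {a b : Fin p} (h : a ≠ b) :
    block (scaled A) a b = zPow K (-Pi.single a 1) • block (-A) a b := by
  ext i j : 1
  simp [block, scaled, h]

/-- Each edge contributes the inverse variable of its source, so the endpoint `b` is not counted and
a closed walk gets exactly its visit numbers. -/
theorem pathProd_scaled (b : Fin p) (l : List (Fin p)) : ∀ a : Fin p,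
    List.IsChain (· ≠ ·) (a :: (l ++ [b])) →
      pathProd (scaled A) a b l
        = zPow K (fun c => -((a :: l).count c : ℤ)) • pathProd (-A) a b l := by
  have e : ∀ a : Fin p, (fun c => -(([a] : List (Fin p)).count c : ℤ)) = -Pi.single a 1 := by
    intro a
    ext c
    by_cases h : a = c
    · subst h; simp
    · simp [h, Ne.symm h]
  induction l with
  | nil =>
    intro a h
    rw [e a]
    exact block_scaled_of_ne A (by simpa using h)
  | cons c l ih =>
    intro a h
    rw [List.cons_append, List.isChain_cons_cons] at h
    have e' : (fun d => -((a :: c :: l).count d : ℤ))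
        = -Pi.single a 1 + fun d => -((c :: l).count d : ℤ) := by
      rw [← e a]
      ext d
      rw [Pi.add_apply, show a :: c :: l = [a] ++ (c :: l) from rfl, List.count_append]
      push_cast
      ring
    rw [pathProd, pathProd, ih c h.2, block_scaled_of_ne A h.1, e', zPow_add, Matrix.smul_mul,
      Matrix.mul_smul, smul_smul]

theorem listHolDet_neg {w : List (Fin p)} (h : Cycle.Chain (· ≠ ·) (w : Cycle (Fin p))) :
    listHolDet (-A) (zPow K fun c => -(w.count c : ℤ)) w = listHolDet (scaled A) 1 w := by
  match w with
  | [] => rfl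
  | a :: l =>
    rw [listHolDet, listHolDet, pathProd_scaled A a l a h, one_smul]

variable {A}

theorem euler_scaled (hoff : ∀ a b : Fin p, a ≠ b → ∃ M : Matrix (Fin (n a)) (Fin (n b)) K,
    block A a b = M.map HahnSeries.C) (x y : Σ a, Fin (n a)) :
    euler (scaled A x y) = scaled A x y := by
  obtain ⟨a, i⟩ := x
  obtain ⟨b, j⟩ := y
  rw [scaled, of_apply]
  split_ifs with h
  · simp
  · obtain ⟨M, hM⟩ := hoff a b h
    have h1 : A ⟨a, i⟩ ⟨b, j⟩ = HahnSeries.C (M i j) := congrFun (congrFun hM i) j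
    rw [h1, ← map_neg, Derivation.leibniz, euler_C, smul_zero, zero_add, euler_zPow, smul_eq_mul]
    simp [mul_comm]

theorem det_eq_mul_det_one_sub_scaled
    (hdiag : ∀ a : Fin p, block A a a
      = zVar K a • (1 : Matrix (Fin (n a)) (Fin (n a)) (LaurentInv p K))) :
    A.det = (zPow K fun a => (n a : ℤ)) * (1 - scaled A).det := by
  have h1 : A = diagonal (fun x => zVar K x.1) * (1 - scaled A) := by
    ext ⟨a, i⟩ ⟨b, j⟩ : 2
    rw [diagonal_mul, Matrix.sub_apply, scaled, of_apply]
    dsimp only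
    split_ifs with h
    · subst h
      have h2 : A ⟨a, i⟩ ⟨a, j⟩ = zVar K a * (1 : Matrix _ _ (LaurentInv p K)) i j :=
        congrFun (congrFun (hdiag a) i) j
      rw [h2, sub_zero, one_apply, one_apply]
      simp
    · rw [one_apply_ne (by simp [h]), zero_sub, mul_neg, neg_mul_eq_mul_neg, zVar, ← mul_neg,
        neg_neg, ← mul_assoc, ← zPow_add, add_neg_cancel, zPow_zero, one_mul]
  have h3 : ∏ x : Σ a, Fin (n a), zVar K x.1 = zPow K fun a => (n a : ℤ) := by
    simp only [zVar]
    rw [prod_zPow, Fintype.sum_sigma]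
    congr 1
    ext b
    simp [Finset.sum_apply, Pi.single_apply]
  conv_lhs => rw [h1]
  rw [det_mul, det_diagonal, h3]

end Scaled

/-! ### Closed walks as powers of prime closed walks -/

section Prime

variable {p : ℕ}

/-- A list representing a prime cyclic walk. -/
def PrimeCyclicWalk.rep (ρ : PrimeCyclicWalk p) : List (Fin p) :=
  Quotient.out (s := List.IsRotated.setoid (Fin p)) ρ.1

theorem PrimeCyclicWalk.coe_rep (ρ : PrimeCyclicWalk p) : (ρ.rep : Cycle (Fin p)) = ρ.1 :=
  Quotient.out_eq (s := List.IsRotated.setoid (Fin p)) ρ.1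

theorem PrimeCyclicWalk.two_le_length_rep (ρ : PrimeCyclicWalk p) : 2 ≤ ρ.rep.length := by
  have := ρ.2.1.1
  rwa [← ρ.coe_rep] at this

theorem PrimeCyclicWalk.rep_ne_nil (ρ : PrimeCyclicWalk p) : ρ.rep ≠ [] := by
  rw [← List.length_pos_iff]
  have := ρ.two_le_length_rep
  omega

theorem PrimeCyclicWalk.chain_rep (ρ : PrimeCyclicWalk p) :
    Cycle.Chain (· ≠ ·) (ρ.rep : Cycle (Fin p)) := by
  rw [ρ.coe_rep]
  exact ρ.2.1.2

theorem PrimeCyclicWalk.rotPeriod_rep (ρ : PrimeCyclicWalk p) :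
    rotPeriod ρ.rep = ρ.rep.length := by
  rw [← listValuation_eq_one_iff ρ.rep_ne_nil]
  have := ρ.2.2
  rwa [← ρ.coe_rep] at this

/-- The map `(ρ, j, i) ↦ (ρ.rep.rotate i) ^ (j + 1)` is a bijection onto the closed walks of length
between 1 and `N`. Rotation invariance turns the choice of `i` into the factor `ρ.rep.length`.
Primes in `S` longer than `N` contribute an empty sum. -/
theorem sum_words_eq_sum_prime {M : Type*} [AddCommMonoid M] (f : List (Fin p) → M)
    (hrot : ∀ l i, f (l.rotate i) = f l)
    (hchain : ∀ l : List (Fin p), ¬ Cycle.Chain (· ≠ ·) (l : Cycle (Fin p)) → f l = 0)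
    (N : ℕ) (S : Finset (PrimeCyclicWalk p))
    (hS : ∀ ρ : PrimeCyclicWalk p, ρ.rep.length ≤ N → ρ ∈ S) :
    ∑ k ∈ Finset.range N, ∑ w ∈ words (Fin p) (k + 1), f w
      = ∑ ρ ∈ S, ∑ j ∈ (Finset.range N).filter (fun j => (j + 1) * ρ.rep.length ≤ N),
          ρ.rep.length • f (listPow ρ.rep (j + 1)) := by
  classical
  set J : PrimeCyclicWalk p → Finset ℕ := fun ρ =>
    (Finset.range N).filter (fun j => (j + 1) * ρ.rep.length ≤ N) with hJ
  set T : Finset (Σ _ : PrimeCyclicWalk p, ℕ × ℕ) :=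
    S.sigma fun ρ => J ρ ×ˢ Finset.range ρ.rep.length with hT
  set g : (Σ _ : PrimeCyclicWalk p, ℕ × ℕ) → List (Fin p) := fun x =>
    listPow (x.1.rep.rotate x.2.2) (x.2.1 + 1) with hg
  have hmemT : ∀ x ∈ T, (x.2.1 + 1) * x.1.rep.length ≤ N ∧ x.2.2 < x.1.rep.length := by
    intro x hx
    simp only [hT, hJ, Finset.mem_sigma, Finset.mem_product, Finset.mem_filter,
      Finset.mem_range] at hx
    exact ⟨hx.2.1.2, hx.2.2⟩
  -- The rotation period of the word recovers the length of the root, the total length then recovers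
  -- `j`, the root its class `ρ`, and primality the rotation `i`.
  have hinj : Set.InjOn g T := by
    rintro ⟨ρ, j, i⟩ hx ⟨ρ', j', i'⟩ hy hxy
    have hi := (hmemT _ hx).2
    have hi' := (hmemT _ hy).2
    simp only [hg] at hxy hi hi'
    have hlen : ρ.rep.length = ρ'.rep.length := by
      have h := congrArg rotPeriod hxy
      rwa [rotPeriod_listPow _ j.succ_pos, rotPeriod_listPow _ j'.succ_pos, rotPeriod_rotate,
        rotPeriod_rotate, ρ.rotPeriod_rep, ρ'.rotPeriod_rep] at h
    have hj : j = j' := by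
      have h := congrArg List.length hxy
      rw [length_listPow, length_listPow, List.length_rotate, List.length_rotate, hlen] at h
      have := Nat.eq_of_mul_eq_mul_right (by omega) h
      omega
    subst hj
    have hu := listPow_injective j.succ_pos hxy
    have hρ : ρ = ρ' := by
      apply Subtype.ext
      rw [← ρ.coe_rep, ← ρ'.coe_rep]
      refine Cycle.coe_eq_coe.2 (List.IsRotated.trans ⟨i, hu⟩ (List.IsRotated.forall _ _))
    subst hρ
    rw [rotate_injOn ρ.rotPeriod_rep hi hi' hu]
  have hright : ∑ ρ ∈ S, ∑ j ∈ J ρ, ρ.rep.length • f (listPow ρ.rep (j + 1))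
      = ∑ w ∈ T.image g, f w := by
    rw [Finset.sum_image hinj, Finset.sum_sigma]
    refine Finset.sum_congr rfl fun ρ _ => ?_
    rw [Finset.sum_product]
    refine Finset.sum_congr rfl fun j _ => ?_
    simp only [hg, ← listPow_rotate, hrot, Finset.sum_const, Finset.card_range]
  rw [hright, ← Finset.sum_biUnion]
  · symm
    refine Finset.sum_subset ?_ ?_
    · intro w hw
      obtain ⟨x, hx, rfl⟩ := Finset.mem_image.1 hw
      have h := hmemT x hx
      have h2 : 0 < (x.2.1 + 1) * x.1.rep.length := Nat.mul_pos (Nat.succ_pos _) (by omega)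
      rw [Finset.mem_biUnion]
      refine ⟨(x.2.1 + 1) * x.1.rep.length - 1, Finset.mem_range.2 (by omega), ?_⟩
      rw [mem_words, hg, length_listPow, List.length_rotate]
      omega
    · intro w hw hw'
      refine hchain w fun hc => hw' ?_
      obtain ⟨k, hk, hwk⟩ := Finset.mem_biUnion.1 hw
      rw [Finset.mem_range] at hk
      rw [mem_words] at hwk
      obtain ⟨u, j, hj, hu0, hu, rfl⟩ := exists_listPow_eq (w := w)
        (by rw [← List.length_pos_iff]; omega)
      rw [length_listPow] at hwk
      have huc := chain_of_chain_listPow hj hc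
      have hu1 := List.length_pos_iff.2 hu0
      -- A root of length 1 would be a loop `a, a`, which the chain condition forbids.
      have hu2 : 2 ≤ u.length := by
        refine Nat.lt_of_le_of_ne hu1 fun h => ?_
        obtain ⟨a, rfl⟩ := List.length_eq_one_iff.1 h.symm
        exact (Cycle.chain_singleton _ a).1 huc rfl
      let ρ : PrimeCyclicWalk p :=
        ⟨(u : Cycle (Fin p)), ⟨hu2, huc⟩, (listValuation_eq_one_iff hu0).2 hu⟩
      have hr : ρ.rep ~r u := Cycle.coe_eq_coe.1 ρ.coe_rep
      have hlen : ρ.rep.length = u.length := hr.perm.length_eq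
      obtain ⟨i, hi, hiu⟩ := exists_rotate_eq_of_isRotated ρ.rep_ne_nil hr
      have hle : j * u.length ≤ N := by omega
      have hjN : j ≤ N := (Nat.le_mul_of_pos_right j hu1).trans hle
      have huN : u.length ≤ N := (Nat.le_mul_of_pos_left _ hj).trans hle
      obtain ⟨j, rfl⟩ := Nat.exists_eq_succ_of_ne_zero hj.ne'
      refine Finset.mem_image.2 ⟨⟨ρ, j, i⟩, ?_, ?_⟩
      · simp only [hT, hJ, Finset.mem_sigma, Finset.mem_product, Finset.mem_filter,
          Finset.mem_range]
        exact ⟨hS ρ (hlen ▸ huN), ⟨hjN, hlen ▸ hle⟩, hi⟩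
      · simp only [hg, hiu]
  · intro k _ k' _ hkk'
    refine Finset.disjoint_left.2 fun w h h' => hkk' ?_
    rw [mem_words] at h h'
    omega

theorem finite_prime_length_le (N : ℕ) : {ρ : PrimeCyclicWalk p | ρ.rep.length ≤ N}.Finite := by
  refine Set.Finite.of_finite_image (f := PrimeCyclicWalk.rep)
    ((List.finite_length_le (Fin p) N).subset ?_) ?_
  · rintro _ ⟨ρ, hρ, rfl⟩
    exact hρ
  · intro ρ _ ρ' _ h
    apply Subtype.ext
    rw [← ρ.coe_rep, ← ρ'.coe_rep, h]

end Prime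

/-! ### The Euler product -/

theorem holDet_neg_eq {p : ℕ} {n : Fin p → ℕ} {K : Type*} [Field K]
    (A : Matrix (Σ a, Fin (n a)) (Σ a, Fin (n a)) (LaurentInv p K))
    (ρ : PrimeCyclicWalk p) :
    holDet (-A) (zPow K fun a => -(visits ρ.1 a : ℤ)) ρ.1 = listHolDet (scaled A) 1 ρ.rep := by
  have h : ∀ a, visits (ρ.rep : Cycle (Fin p)) a = ρ.rep.count a := fun a =>
    Multiset.coe_count a ρ.rep
  rw [← listHolDet_neg A ρ.chain_rep, ← ρ.coe_rep]
  simp only [h]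
  rfl

section Main

open Matrix

variable {p : ℕ} {n : Fin p → ℕ} {K : Type*} [Field K] [CharZero K]
  {X : Matrix (Σ a, Fin (n a)) (Σ a, Fin (n a)) (LaurentInv p K)}

/-- The truncation at order `N` of `|w| ∑ⱼ tr (hol(X, w) ^ j)`, for a list `w`. -/
def primeLogDeriv (X : Matrix (Σ a, Fin (n a)) (Σ a, Fin (n a)) (LaurentInv p K)) (N : ℕ)
    (w : List (Fin p)) : LaurentInv p K :=
  (w.length : LaurentInv p K) * ∑ j ∈ Finset.range N, listTrace X (listPow w (j + 1))

theorem pathProd_mem_filt (hX : ∀ x y, euler (X x y) = X x y) (a b : Fin p) (l : List (Fin p))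
    (i : Fin (n a)) (j : Fin (n b)) : pathProd X a b l i j ∈ filt p K (l.length + 1) :=
  mem_filt_of_euler_eq (derivation_pathProd euler X hX b l a i j)

theorem listTrace_mem_filt (hX : ∀ x y, euler (X x y) = X x y) (w : List (Fin p)) :
    listTrace X w ∈ filt p K w.length := by
  match w with
  | [] => exact zero_mem _
  | a :: l => exact sum_mem fun i _ => pathProd_mem_filt hX a a l i i

theorem euler_listHolDet_mem_filt (hX : ∀ x y, euler (X x y) = X x y) (N : ℕ)
    {w : List (Fin p)} (hw : w ≠ []) :
    listHolDet X 1 w - 1 ∈ filt p K 1 ∧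
      euler (listHolDet X 1 w) + primeLogDeriv X N w * listHolDet X 1 w ∈ filt p K (N + 1) := by
  match w, hw with
  | a :: l, _ =>
    have h1 : ∀ i j, pathProd X a a l i j ∈ filt p K 1 := fun i j =>
      filt_anti (Nat.le_add_left 1 _) (pathProd_mem_filt hX a a l i j)
    rw [listHolDet, one_smul]
    refine ⟨det_one_sub_sub_one_mem_filt h1, ?_⟩
    have h2 := euler_det_one_sub_mem_filt (derivation_pathProd euler X hX a l a) h1 N
    simp only [trace_pathProd_pow] at h2
    exact h2

/-- Both terms solve the same logarithmic equation modulo degree `N + 1`. Leaving `S` arbitrary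
above the short primes is what makes the convergence unconditional. -/
theorem det_one_sub_sub_prod_mem_filt (hX : ∀ x y, euler (X x y) = X x y)
    (hX0 : ∀ a, block X a a = 0) (N : ℕ) (S : Finset (PrimeCyclicWalk p))
    (hS : ∀ ρ : PrimeCyclicWalk p, ρ.rep.length ≤ N → ρ ∈ S) :
    (1 - X).det - ∏ ρ ∈ S, listHolDet X 1 ρ.rep ∈ filt p K (N + 1) := by
  have hX' : ∀ x y, euler (X x y) = ((1 : ℕ) : LaurentInv p K) * X x y := fun x y => by
    rw [hX, Nat.cast_one, one_mul]
  have hX1 : ∀ x y, X x y ∈ filt p K 1 := fun x y => mem_filt_of_euler_eq (hX' x y)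
  have hD := euler_det_one_sub_mem_filt hX' hX1 N
  obtain ⟨hP1, hP⟩ := prod_euler_mem_filt (N := N) S (fun ρ => listHolDet X 1 ρ.rep)
    (fun ρ => primeLogDeriv X N ρ.rep)
    (fun ρ _ => (euler_listHolDet_mem_filt hX N ρ.rep_ne_nil).1)
    (fun ρ _ => (euler_listHolDet_mem_filt hX N ρ.rep_ne_nil).2)
  refine sub_mem_filt_of_euler (det_one_sub_sub_one_mem_filt hX1) hP1 ?_ ?_ hD hP
  · rw [← nsmul_eq_mul]
    refine nsmul_mem (sum_mem fun j _ => sum_mem fun i _ => ?_) _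
    exact filt_anti (by omega) (matrix_pow_mem_filt hX1 (j + 1) i i)
  · simp only [trace_pow, Nat.cast_one, one_mul]
    rw [sum_words_eq_sum_prime (listTrace X) (listTrace_rotate X)
      (fun l => listTrace_eq_zero X hX0) N S hS, ← Finset.sum_sub_distrib]
    refine sum_mem fun ρ _ => ?_
    rw [primeLogDeriv, ← nsmul_eq_mul, Finset.smul_sum, ← neg_mem_iff, neg_sub,
      Finset.sum_filter, ← Finset.sum_sub_distrib]
    refine sum_mem fun j _ => ?_
    -- Terms with `(j + 1) * |ρ| ≤ N` cancel; the others are traces of degree at least `N + 1`.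
    split_ifs with h
    · rw [sub_self]
      exact zero_mem _
    · rw [sub_zero]
      refine nsmul_mem (filt_anti ?_ (listTrace_mem_filt hX _)) _
      rw [length_listPow]
      omega

theorem hasProd_listHolDet (hX : ∀ x y, euler (X x y) = X x y)
    (hX0 : ∀ a, block X a a = 0) :
    HasProd (fun ρ : PrimeCyclicWalk p => listHolDet X 1 ρ.rep) (1 - X).det := by
  refine tendsto_of_sub_mem_filt fun N => ?_
  rw [SummationFilter.unconditional_filter]
  filter_upwards [Filter.eventually_ge_atTop (finite_prime_length_le (p := p) N).toFinset]
    with S hS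
  exact det_one_sub_sub_prod_mem_filt hX hX0 N S fun ρ hρ => hS (by simpa using hρ)

end Main

end BlockEuler

end

theorem proposition4p1 {K : Type*} [Field K] [CharZero K] (p : ℕ) (n : Fin p → ℕ)
    (A : Matrix (Σ a, Fin (n a)) (Σ a, Fin (n a)) (BlockEuler.LaurentInv p K))
    (hdiag : ∀ a : Fin p, BlockEuler.block A a a =
      BlockEuler.zVar K a • (1 : Matrix (Fin (n a)) (Fin (n a)) (BlockEuler.LaurentInv p K)))
    (hoff : ∀ a b : Fin p, a ≠ b → ∃ M : Matrix (Fin (n a)) (Fin (n b)) K,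
      BlockEuler.block A a b = M.map HahnSeries.C) :
    Multipliable (fun ρ : BlockEuler.PrimeCyclicWalk p =>
        BlockEuler.holDet (-A) (BlockEuler.zPow K fun a => -(BlockEuler.visits ρ.1 a : ℤ)) ρ.1) ∧
      A.det = (BlockEuler.zPow K fun a => (n a : ℤ)) *
        ∏' ρ : BlockEuler.PrimeCyclicWalk p,
          BlockEuler.holDet (-A) (BlockEuler.zPow K fun a => -(BlockEuler.visits ρ.1 a : ℤ)) ρ.1 := by
  have h := BlockEuler.hasProd_listHolDet (BlockEuler.euler_scaled hoff)
    (BlockEuler.block_scaled_self A)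
  simp only [← BlockEuler.holDet_neg_eq] at h
  exact ⟨h.multipliable, by
    rw [h.tprod_eq, BlockEuler.det_eq_mul_det_one_sub_scaled hdiag]⟩
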